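/- Let $\mathbb K=\mathbb R$ or $\mathbb C$. For a sequence $V=(V_n)_{n\in\mathbb Z}$ of vectors in a $\mathbb K$-vector space with a symmetric bilinear form $\langle\cdot,\cdot\rangle$ put $v_{m,n}=\langle V_m,V_n\rangle$ and assume $v_{n,n}=1$. $T$ is the shift $n\mapsto n+1$; the index $n$ is omitted, so $V_{\pm1}$ stands for $V_{n\pm1}$, $v_{m,k}$ for $v_{n+m,n+k}$, and a lower index $j$ on a function of the $v_{m,k}$ denotes the application of $T^j$. An isotropic lattice on the sphere is an equation $V_x=fV_1+gV+hV_{-1}$, where $f,g,h$ are smooth functions of $(v_{1,-1},v_{1,0},v_{0,-1})$ on an open set, $f\neq0$ there, and $v_{1,0}f+g+v_{0,-1}h=0$. Consider the lattices $$(V_1)\quad V_x=\frac{a(V_1-v_{1,0}V)+a_1(v_{0,-1}V-V_{-1})}{v_{1,-1}-v_{1,0}v_{0,-1}},\quad a=v_{0,-1}-\frac1{v_{0,-1}};$$ $$(V_2)\quad V_x=\frac{a(V_1-v_{1,0}V)+a_1(v_{0,-1}V-V_{-1})}{v_{1,-1}-v_{1,0}v_{0,-1}+aa_1},\quad a^2-2kv_{0,-1}a+v_{0,-1}^2-1=0;$$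 $$(V_3),(V_4),(V_5)\quad V_x=\frac{(v_{0,-1}+\varepsilon)(V_1+\varepsilon V)-(v_{1,0}+\varepsilon)(V_{-1}+\varepsilon V)}{\Delta},\quad \varepsilon=\pm1,$$ with, respectively, $\Delta=v_{1,-1}-1$; $\Delta=v_{1,-1}-v_{1,0}v_{0,-1}+(v_{1,0}+\varepsilon)(v_{0,-1}+\varepsilon)(k+\pi\pi_1)$, $\pi=\sqrt{\frac{v_{0,-1}-\varepsilon}{v_{0,-1}+\varepsilon}-k}$; $\Delta=v_{1,-1}+\varepsilon(v_{1,0}+v_{0,-1})+1+k\sqrt{v_{1,0}+\varepsilon}\sqrt{v_{0,-1}+\varepsilon}$, $k\in\{0,2,-2\}$; $$(V_6)\quad V_x=\frac{V_1+\delta V}{v_{1,0}+\delta}-\frac{V_{-1}+\delta V}{v_{0,-1}+\delta},\quad\delta\in\{0,1,-1\}.$$ In $(V_2)$ and $(V_4)$ the constant $k\in\mathbb K$ is arbitrary; algebraic functions are represented by any smooth branch on an open set $U\subset\mathbb K$ of values of $v_{0,-1}$, the same at all sites (for $\mathbb K=\mathbb R$ the two square roots in a product may be simultaneously imaginary, so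 that the product is real). Each lattice is considered where its denominators and $f$ do not vanish. Put $p=-f_{v_{1,-1}}/f^2$ and $$A=v_{1,-1}f+v_{0,-1}g+h,\qquad B=f+v_{1,0}g+v_{1,-1}h,$$ $$C=p_1g_1+(\log f_1f)_{v_{1,0}},\qquad D=pg_{-1}-(\log ff_{-1})_{v_{0,-1}}.$$ The set of regular points consists of the arrays $(v_{m,n})$, symmetric and with $v_{n,n}=1$, for which the lattice is defined at all sites; the generic points are the regular points at which $A$ and $B$ do not vanish at any site. A local function is a smooth function of finitely many $v_{m,n}$; on a given set of points, $\varphi\in\operatorname{Im}(T-1)$ means $\varphi=(T-1)\sigma$ with a local function $\sigma$. A lattice *has a presymplectic form* if there are local functions $p,q,r,\lambda$ on the set of generic points, the same for all vector spaces and all symmetric bilinear forms, such that at all sequences $V$ with generic $(v_{m,n})$ $$SV_x=\frac{\delta H}{\delta V}+\lambda V,\qquad H=\log f,\tag{1}$$ where $$S=pT^{-1}-p_1T-qV_{-1}V^\top T^{-1}+q_1V_1V^\top T+r(V_1V_{-1}^\top-V_{-1}V_1^\top)$$ is skew-symmetric with respect to $\sum_n\langle U_n,W_n\rangle$ ($U$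 finitely supported), $UV^\top(W)=U\langle V,W\rangle$, and $\delta H/\delta V=\sum_mT^{-m}(\partial H/\partial V_m)$, with the gradients of $H$ as a function of the scalar products. Then: 1. Each of the lattices $(V_1)$–$(V_6)$ has a presymplectic form. 2. For every isotropic lattice on the sphere satisfying $pf+p_1h=0$ (with $p=-f_{v_{1,-1}}/f^2$) at the regular points, the following are equivalent: (a) it has a presymplectic form; (b) the system $Ar+A_1q_1=C$, $Br+B_{-1}q=D$ has a solution in local functions $q,r$ on the set of generic points; (c) $BC-AD\in\operatorname{Im}(T-1)$ on the set of generic points; (d) $D_x(\log f)\in\operatorname{Im}(T-1)$ on the set of generic points, where $D_x$ is the derivative in virtue of the lattice. 3. Each of the lattices $(V_1)$–$(V_6)$ is an isotropic lattice on the sphere satisfying $pf+p_1h=0$ at the regular points, $BC-AD\in\operatorname{Im}(T-1)$ on the set of generic points, and $D_x(\log f)\in\operatorname{Im}(T-1)$ on the set of regular points. -/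

import Mathlib

open scoped ContDiff

universe u v

/-- The dynamical variables: the array of scalar products `v m n = ⟨V_m, V_n⟩`. -/
abbrev DynVars (𝕜 : Type u) : Type u := ℤ → ℤ → 𝕜

namespace DynVars

variable {𝕜 : Type u}

/-- The array seen from site `k`; a function `φ` of the dynamical variables has the value
`φ (v.shift k)` at site `k`, that is, `T^k φ = fun v => φ (v.shift k)`. -/
def shift (v : DynVars 𝕜) (k : ℤ) : DynVars 𝕜 := fun m n => v (m + k) (n + k)

/-- The finite array of the variables `v m n` with `|m|, |n| ≤ N`. -/
def window (N : ℕ) (v : DynVars 𝕜) :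
    Finset.Icc (-(N : ℤ)) N → Finset.Icc (-(N : ℤ)) N → 𝕜 := fun i j => v i j

/-- `φ` is, on the set `X`, a smooth function of finitely many dynamical variables. -/
def IsLocalOn [RCLike 𝕜] (X : Set (DynVars 𝕜)) (φ : DynVars 𝕜 → 𝕜) : Prop :=
  ∃ (N : ℕ) (Φ : (Finset.Icc (-(N : ℤ)) N → Finset.Icc (-(N : ℤ)) N → 𝕜) → 𝕜),
    ∀ v ∈ X, ContDiffAt 𝕜 ∞ Φ (window N v) ∧ φ v = Φ (window N v)

/-- `φ ∈ Im (T - 1)` on `X`: one has `φ = T σ - σ` on `X` with a smooth local function `σ`. -/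
def InImShiftSubOne [RCLike 𝕜] (X : Set (DynVars 𝕜)) (φ : DynVars 𝕜 → 𝕜) : Prop :=
  ∃ σ : DynVars 𝕜 → 𝕜, IsLocalOn X σ ∧ ∀ v ∈ X, φ v = σ (v.shift 1) - σ v

end DynVars

/-- The data of an isotropic vector Volterra lattice `V_x = f V_1 + g V + h V_{-1}`. The
coefficients are functions of `(x, y, z) = (v_{1,-1}, v_{1,0}, v_{0,-1})` on the set `dom`. -/
structure VolterraLattice (𝕜 : Type u) where
  dom : Set (𝕜 × 𝕜 × 𝕜)
  f : 𝕜 → 𝕜 → 𝕜 → 𝕜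
  g : 𝕜 → 𝕜 → 𝕜 → 𝕜
  h : 𝕜 → 𝕜 → 𝕜 → 𝕜

namespace VolterraLattice

variable {𝕜 : Type u} [RCLike 𝕜]

/-- Smooth coefficients on an open domain, `f` without zeros (so that `log f` makes sense), and
the condition `v_{1,0} f + g + v_{0,-1} h = 0` that the lattice preserves `⟨V_n, V_n⟩ = 1`. -/
structure IsOnSphere (L : VolterraLattice 𝕜) : Prop where
  isOpen_dom : IsOpen L.dom
  smooth_f : ContDiffOn 𝕜 ∞ (fun w : 𝕜 × 𝕜 × 𝕜 => L.f w.1 w.2.1 w.2.2) L.dom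
  smooth_g : ContDiffOn 𝕜 ∞ (fun w : 𝕜 × 𝕜 × 𝕜 => L.g w.1 w.2.1 w.2.2) L.dom
  smooth_h : ContDiffOn 𝕜 ∞ (fun w : 𝕜 × 𝕜 × 𝕜 => L.h w.1 w.2.1 w.2.2) L.dom
  f_ne_zero : ∀ x y z, (x, y, z) ∈ L.dom → L.f x y z ≠ 0
  sphere : ∀ x y z, (x, y, z) ∈ L.dom → y * L.f x y z + L.g x y z + z * L.h x y z = 0

variable (L : VolterraLattice 𝕜)

/-- Values of the coefficients at site `0`. -/
def fv (v : DynVars 𝕜) : 𝕜 := L.f (v 1 (-1)) (v 1 0) (v 0 (-1))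

def gv (v : DynVars 𝕜) : 𝕜 := L.g (v 1 (-1)) (v 1 0) (v 0 (-1))

def hv (v : DynVars 𝕜) : 𝕜 := L.h (v 1 (-1)) (v 1 0) (v 0 (-1))

/-- The partial derivatives of `log f` in `v_{1,-1}`, `v_{1,0}`, `v_{0,-1}` at site `0`. -/
noncomputable def logX (v : DynVars 𝕜) : 𝕜 :=
  logDeriv (fun t => L.f t (v 1 0) (v 0 (-1))) (v 1 (-1))

noncomputable def logY (v : DynVars 𝕜) : 𝕜 :=
  logDeriv (fun t => L.f (v 1 (-1)) t (v 0 (-1))) (v 1 0)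

noncomputable def logZ (v : DynVars 𝕜) : 𝕜 :=
  logDeriv (fun t => L.f (v 1 (-1)) (v 1 0) t) (v 0 (-1))

/-- `D_x v_{m,n} = ⟨V_{m,x}, V_n⟩ + ⟨V_m, V_{n,x}⟩` in virtue of the lattice. -/
def dx (v : DynVars 𝕜) (m n : ℤ) : 𝕜 :=
  (L.fv (v.shift m) * v (m + 1) n + L.gv (v.shift m) * v m n + L.hv (v.shift m) * v (m - 1) n)
  + (L.fv (v.shift n) * v m (n + 1) + L.gv (v.shift n) * v m n + L.hv (v.shift n) * v m (n - 1))

/-- `D_x (log f)`. -/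
noncomputable def dxLogF (v : DynVars 𝕜) : 𝕜 :=
  L.logX v * L.dx v 1 (-1) + L.logY v * L.dx v 1 0 + L.logZ v * L.dx v 0 (-1)

/-- `p = - f_{v_{1,-1}} / f^2`. -/
noncomputable def pv (v : DynVars 𝕜) : 𝕜 := -(L.logX v / L.fv v)

/-- `A = v_{1,-1} f + v_{0,-1} g + h`, that is, `A = ⟨V_{-1}, V_x⟩`. -/
def coefA (v : DynVars 𝕜) : 𝕜 := v 1 (-1) * L.fv v + v 0 (-1) * L.gv v + L.hv v

/-- `B = f + v_{1,0} g + v_{1,-1} h`, that is, `B = ⟨V_1, V_x⟩`. -/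
def coefB (v : DynVars 𝕜) : 𝕜 := L.fv v + v 1 0 * L.gv v + v 1 (-1) * L.hv v

/-- `C = p_1 g_1 + (log (f_1 f))_{v_{1,0}}`. -/
noncomputable def coefC (v : DynVars 𝕜) : 𝕜 :=
  L.pv (v.shift 1) * L.gv (v.shift 1) + (L.logZ (v.shift 1) + L.logY v)

/-- `D = p g_{-1} - (log (f f_{-1}))_{v_{0,-1}}`. -/
noncomputable def coefD (v : DynVars 𝕜) : 𝕜 :=
  L.pv v * L.gv (v.shift (-1)) - (L.logZ v + L.logY (v.shift (-1)))

/-- Arrays of scalar products of unit vectors at which the lattice is defined at every site. -/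
def regular : Set (DynVars 𝕜) :=
  {v | (∀ m n, v m n = v n m) ∧ (∀ n, v n n = 1) ∧
    ∀ n, (v (n + 1) (n - 1), v (n + 1) n, v n (n - 1)) ∈ L.dom}

/-- The regular arrays at which neither `A` nor `B` vanishes at any site. -/
def generic : Set (DynVars 𝕜) :=
  {v | v ∈ L.regular ∧ ∀ n, L.coefA (v.shift n) ≠ 0 ∧ L.coefB (v.shift n) ≠ 0}

/-- The identity `p f + p_1 h = 0` with `p = - f_{v_{1,-1}} / f^2`. -/
def LeadingCondition : Prop :=
  ∀ v ∈ L.regular, L.pv v * L.fv v + L.pv (v.shift 1) * L.hv v = 0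

section Vectors

variable {E : Type v} [AddCommGroup E] [Module 𝕜 E] (B : LinearMap.BilinForm 𝕜 E)

/-- The scalar products of a sequence of vectors. -/
def gram (V : ℤ → E) : DynVars 𝕜 := fun m n => B (V m) (V n)

/-- The right-hand side `f V_1 + g V + h V_{-1}` of the lattice, at site `n`. -/
def field (V : ℤ → E) (n : ℤ) : E :=
  L.fv ((gram B V).shift n) • V (n + 1) + L.gv ((gram B V).shift n) • V n
    + L.hv ((gram B V).shift n) • V (n - 1)

/-- The variational derivative `δH/δV` of `H = log f(v_{1,-1}, v_{1,0}, v_{0,-1})` at site `n`,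
`∑_m ∂H_m/∂V_n`. The three lines are the gradients in `V_n` of the terms `H_m` with
`m = n - 1`, `m = n` and `m = n + 1`, where
`H_m = log f(⟨V_{m+1}, V_{m-1}⟩, ⟨V_{m+1}, V_m⟩, ⟨V_m, V_{m-1}⟩)`. -/
noncomputable def varDerivLogF (V : ℤ → E) (n : ℤ) : E :=
  (L.logX ((gram B V).shift (n - 1)) • V (n - 2) + L.logY ((gram B V).shift (n - 1)) • V (n - 1))
  + (L.logY ((gram B V).shift n) • V (n + 1) + L.logZ ((gram B V).shift n) • V (n - 1))
  + (L.logX ((gram B V).shift (n + 1)) • V (n + 2) + L.logZ ((gram B V).shift (n + 1)) • V (n + 1))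

/-- The operator `p T⁻¹ - p_1 T - q V_{-1} Vᵀ T⁻¹ + q_1 V_1 Vᵀ T + r (V_1 V_{-1}ᵀ - V_{-1} V_1ᵀ)`
applied to the sequence `W`, at site `n`. Here `(X Yᵀ) Z = ⟨Y, Z⟩ X`, and `p`, `q`, `r` are
functions of the dynamical variables. -/
def opS (p q r : DynVars 𝕜 → 𝕜) (V W : ℤ → E) (n : ℤ) : E :=
  p ((gram B V).shift n) • W (n - 1) - p ((gram B V).shift (n + 1)) • W (n + 1)
  - (q ((gram B V).shift n) * B (V n) (W (n - 1))) • V (n - 1)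
  + (q ((gram B V).shift (n + 1)) * B (V n) (W (n + 1))) • V (n + 1)
  + r ((gram B V).shift n) •
      (B (V (n - 1)) (W n) • V (n + 1) - B (V (n + 1)) (W n) • V (n - 1))

/-- Skew-symmetry with respect to the pairing `∑_n ⟨U_n, W_n⟩`. -/
def IsSkew (S : (ℤ → E) → ℤ → E) : Prop :=
  ∀ U W : ℤ → E, U.support.Finite → ∑ᶠ n, B (U n) (S W n) = -∑ᶠ n, B (S U n) (W n)

end Vectors

/-- `S V_x = δH/δV + λ V` with `H = log f` and `S` skew-symmetric, for generic sequences of unit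
vectors `V` in an arbitrary space with an arbitrary scalar product. -/
def IsPresymplecticForm (p q r lam : DynVars 𝕜 → 𝕜) : Prop :=
  ∀ (E : Type (max u v)) [AddCommGroup E] [Module 𝕜 E] (B : LinearMap.BilinForm 𝕜 E),
    B.IsSymm → ∀ V : ℤ → E, gram B V ∈ L.generic →
      IsSkew B (opS B p q r V) ∧
      ∀ n, opS B p q r V (L.field B V) n
        = L.varDerivLogF B V n + lam ((gram B V).shift n) • V n

/-- The lattice can be written in presymplectic form, with coefficients that are smooth functions
of finitely many scalar products (the same functions for all spaces). -/
def HasPresymplecticForm : Prop :=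
  ∃ p q r lam : DynVars 𝕜 → 𝕜,
    DynVars.IsLocalOn L.generic p ∧ DynVars.IsLocalOn L.generic q ∧
    DynVars.IsLocalOn L.generic r ∧ DynVars.IsLocalOn L.generic lam ∧
    IsPresymplecticForm.{u, v} L p q r lam

/-- The system `A r + A_1 q_1 = C`, `B r + B_{-1} q = D` is solvable for `q`, `r`. -/
def SystemSolvable : Prop :=
  ∃ q r : DynVars 𝕜 → 𝕜, DynVars.IsLocalOn L.generic q ∧ DynVars.IsLocalOn L.generic r ∧
    ∀ v ∈ L.generic,
      L.coefA v * r v + L.coefA (v.shift 1) * q (v.shift 1) = L.coefC v ∧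
      L.coefB v * r v + L.coefB (v.shift (-1)) * q v = L.coefD v

/-- The lattice `(a(z) (V_1 + c V) - a(y) (V_{-1} + d V)) / Δ` on the set of all `(x, y, z)` with
`y, z ∈ U`, `a(z) ≠ 0`, `Δ ≠ 0`; here `c`, `d` and `Δ` depend on `(x, y, z)`. -/
def ofFraction (U : Set 𝕜) (a : 𝕜 → 𝕜) (c d Δ : 𝕜 → 𝕜 → 𝕜 → 𝕜) : VolterraLattice 𝕜 where
  dom := {w | w.2.1 ∈ U ∧ w.2.2 ∈ U ∧ a w.2.2 ≠ 0 ∧ Δ w.1 w.2.1 w.2.2 ≠ 0}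
  f x y z := a z / Δ x y z
  g x y z := (a z * c x y z - a y * d x y z) / Δ x y z
  h x y z := -a y / Δ x y z

/-- `a = v - 1/v`, `Δ = v_{1,-1} - v_{1,0} v_{0,-1}`. -/
noncomputable def lattice1 : VolterraLattice 𝕜 :=
  ofFraction {t | t ≠ 0} (fun t => t - 1 / t) (fun _ y _ => -y) (fun _ _ z => -z)
    (fun x y z => x - y * z)

/-- `Δ = v_{1,-1} - v_{1,0} v_{0,-1} + a a_1`. -/
def lattice2 (U : Set 𝕜) (a : 𝕜 → 𝕜) : VolterraLattice 𝕜 :=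
  ofFraction U a (fun _ y _ => -y) (fun _ _ z => -z) (fun x y z => x - y * z + a z * a y)

/-- `a = v + ε`, `Δ = v_{1,-1} - 1`. -/
def lattice3 (ε : 𝕜) : VolterraLattice 𝕜 :=
  ofFraction Set.univ (fun t => t + ε) (fun _ _ _ => ε) (fun _ _ _ => ε) (fun x _ _ => x - 1)

/-- `a = v + ε`,
`Δ = v_{1,-1} - v_{1,0} v_{0,-1} + (v_{1,0} + ε) (v_{0,-1} + ε) (k + η p p_1)`. -/
def lattice4 (ε k η : 𝕜) (U : Set 𝕜) (p : 𝕜 → 𝕜) : VolterraLattice 𝕜 :=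
  ofFraction U (fun t => t + ε) (fun _ _ _ => ε) (fun _ _ _ => ε)
    (fun x y z => x - y * z + (y + ε) * (z + ε) * (k + η * (p z * p y)))

/-- `a = v + ε`, `Δ = v_{1,-1} + ε (v_{1,0} + v_{0,-1}) + 1 + k s s_1`. -/
def lattice5 (ε k : 𝕜) (U : Set 𝕜) (s : 𝕜 → 𝕜) : VolterraLattice 𝕜 :=
  ofFraction U (fun t => t + ε) (fun _ _ _ => ε) (fun _ _ _ => ε)
    (fun x y z => x + ε * (y + z) + 1 + k * (s y * s z))

/-- `(V_1 + δ V) / (v_{1,0} + δ) - (V_{-1} + δ V) / (v_{0,-1} + δ)`. -/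
noncomputable def lattice6 (δ : 𝕜) : VolterraLattice 𝕜 where
  dom := {w | w.2.1 + δ ≠ 0 ∧ w.2.2 + δ ≠ 0}
  f _ y _ := 1 / (y + δ)
  g _ y z := δ / (y + δ) - δ / (z + δ)
  h _ _ z := -1 / (z + δ)

/-- The six families of lattices. Algebraic functions are given by an arbitrary smooth branch on
an open set `U`. Over the reals, the square roots at neighbouring sites may be imaginary
simultaneously, so that only their product is real: the sign `η` takes care of this (the square
root is `√η p` or `√η s`; over the complex numbers `η = 1` suffices). -/
inductive IsListed : VolterraLattice 𝕜 → Prop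
  | v1 : IsListed lattice1
  | v2 (k : 𝕜) (U : Set 𝕜) (a : 𝕜 → 𝕜) (hU : IsOpen U) (ha : ContDiffOn 𝕜 ∞ a U)
      (ha' : ∀ t ∈ U, a t ^ 2 - 2 * k * t * a t + t ^ 2 - 1 = 0) : IsListed (lattice2 U a)
  | v3 (ε : 𝕜) (hε : ε = 1 ∨ ε = -1) : IsListed (lattice3 ε)
  | v4 (ε k η : 𝕜) (hε : ε = 1 ∨ ε = -1) (hη : η = 1 ∨ η = -1) (U : Set 𝕜) (p : 𝕜 → 𝕜)
      (hU : IsOpen U) (hp : ContDiffOn 𝕜 ∞ p U)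
      (hp' : ∀ t ∈ U, t + ε ≠ 0 ∧ η * p t ^ 2 = (t - ε) / (t + ε) - k) :
      IsListed (lattice4 ε k η U p)
  | v5_zero (ε : 𝕜) (hε : ε = 1 ∨ ε = -1) : IsListed (lattice5 ε 0 Set.univ 0)
  | v5_two (ε k η : 𝕜) (hε : ε = 1 ∨ ε = -1) (hk : k = 2 ∨ k = -2) (hη : η = 1 ∨ η = -1)
      (U : Set 𝕜) (s : 𝕜 → 𝕜) (hU : IsOpen U) (hs : ContDiffOn 𝕜 ∞ s U)
      (hs' : ∀ t ∈ U, η * s t ^ 2 = t + ε) : IsListed (lattice5 ε (k * η) U s)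
  | v6 (δ : 𝕜) (hδ : δ = 0 ∨ δ = 1 ∨ δ = -1) : IsListed (lattice6 δ)

end VolterraLattice

/-! ### Shifts and smooth functions of finitely many scalar products. -/

namespace DynVars

variable {𝕜 : Type u}

/-! Because p, q, r, λ serve all spaces, (1) can be tested on a linearly independent sequence V
(`exists_gram_eq`), and it becomes five scalar equations, the coefficients of V_2, …, V_{-2}
(`opS_field_sub_varDerivLogF`). The coefficient of V_2 forces p = -f_{v_{1,-1}}/f², that of V_{-2}
is then pf + p_1h = 0 shifted by -1, that of V gives λ, and those of V_{±1} are the linear system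
for q, r. Skew-symmetry is automatic (`isSkew_opS`).

Eliminating r from the system gives BC - AD = (T-1)(A B_{-1} q). Where A and B do not vanish this
can be solved back for q and r, so solvability means BC - AD ∈ Im(T-1). By `sub_dxLogF_mem`, BC - AD
equals D_x(log f) modulo Im(T-1), which gives the equivalences.

For (V_1)–(V_5) one has f = a(v_{0,-1})/(v_{1,-1} + b) with b symmetric in v_{1,0}, v_{0,-1}. Then p
= 1/a, the leading condition is immediate, and `ofFraction_mem_image` turns BC - AD ∈ Im(T-1) into
identities in two variables y = v_{1,0}, z = v_{0,-1}, checked by differentiating the algebraic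
equation of the branch. In (V_6), p = 0 and D_x(log f) telescopes directly. -/

@[simp] theorem shift_apply (v : DynVars 𝕜) (k m n : ℤ) : v.shift k m n = v (m + k) (n + k) := rfl

theorem shift_shift (v : DynVars 𝕜) (k l : ℤ) : (v.shift k).shift l = v.shift (l + k) := by
  funext m n
  simp only [shift_apply]
  congr 1 <;> ring

@[simp] theorem shift_zero (v : DynVars 𝕜) : v.shift 0 = v := by
  funext m n
  simp

variable [RCLike 𝕜] {X : Set (DynVars 𝕜)}

/-- A local function, seen from site `k`, is local, and the window may be enlarged. -/
theorem exists_window_shift (k : ℤ) {N N' : ℕ} (h : (N : ℤ) + |k| ≤ N')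
    (Φ : (Finset.Icc (-(N : ℤ)) N → Finset.Icc (-(N : ℤ)) N → 𝕜) → 𝕜) :
    ∃ Ψ : (Finset.Icc (-(N' : ℤ)) N' → Finset.Icc (-(N' : ℤ)) N' → 𝕜) → 𝕜,
      ∀ v : DynVars 𝕜, (ContDiffAt 𝕜 ∞ Φ (window N (v.shift k)) →
        ContDiffAt 𝕜 ∞ Ψ (window N' v)) ∧ Ψ (window N' v) = Φ (window N (v.shift k)) := by
  have hm : ∀ i : Finset.Icc (-(N : ℤ)) N, (i : ℤ) + k ∈ Finset.Icc (-(N' : ℤ)) N' := by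
    rintro ⟨i, hi⟩
    rw [Finset.mem_Icc] at hi ⊢
    have := neg_abs_le k
    have := le_abs_self k
    constructor <;> simp only <;> omega
  refine ⟨fun w => Φ fun i j => w ⟨i + k, hm i⟩ ⟨j + k, hm j⟩, fun v => ⟨fun hv => ?_, rfl⟩⟩
  refine ContDiffAt.comp (g := Φ) (window N' v) hv ?_
  exact (contDiff_pi.2 fun i => contDiff_pi.2 fun j => by fun_prop).contDiffAt

namespace IsLocalOn

theorem mono {Y : Set (DynVars 𝕜)} {φ : DynVars 𝕜 → 𝕜} (h : IsLocalOn X φ) (hY : Y ⊆ X) :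
    IsLocalOn Y φ := by
  obtain ⟨N, Φ, hΦ⟩ := h
  exact ⟨N, Φ, fun v hv => hΦ v (hY hv)⟩

theorem shift {φ : DynVars 𝕜 → 𝕜} (h : IsLocalOn X φ) (k : ℤ)
    (hX : ∀ v ∈ X, v.shift k ∈ X) : IsLocalOn X fun v => φ (v.shift k) := by
  obtain ⟨N, Φ, hΦ⟩ := h
  obtain ⟨Ψ, hΨ⟩ := exists_window_shift k (N := N) (N' := N + k.natAbs) (by simp) Φ
  exact ⟨_, Ψ, fun v hv => ⟨(hΨ v).1 (hΦ _ (hX v hv)).1,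
    (hΦ _ (hX v hv)).2.trans (hΨ v).2.symm⟩⟩

theorem enlarge {N N' : ℕ} (h : N ≤ N') {φ : DynVars 𝕜 → 𝕜}
    {Φ : (Finset.Icc (-(N : ℤ)) N → Finset.Icc (-(N : ℤ)) N → 𝕜) → 𝕜}
    (hΦ : ∀ v ∈ X, ContDiffAt 𝕜 ∞ Φ (window N v) ∧ φ v = Φ (window N v)) :
    ∃ Ψ : (Finset.Icc (-(N' : ℤ)) N' → Finset.Icc (-(N' : ℤ)) N' → 𝕜) → 𝕜,
      ∀ v ∈ X, ContDiffAt 𝕜 ∞ Ψ (window N' v) ∧ φ v = Ψ (window N' v) := by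
  obtain ⟨Ψ, hΨ⟩ := exists_window_shift 0 (N := N) (N' := N') (by simpa using h) Φ
  simp only [shift_zero] at hΨ
  exact ⟨Ψ, fun v hv => ⟨(hΨ v).1 (hΦ v hv).1, (hΦ v hv).2.trans (hΨ v).2.symm⟩⟩

theorem coord (m n : ℤ) : IsLocalOn X fun v => v m n := by
  have hm : m ∈ Finset.Icc (-((m.natAbs + n.natAbs : ℕ) : ℤ)) (m.natAbs + n.natAbs : ℕ) := by
    rw [Finset.mem_Icc]; omega
  have hn : n ∈ Finset.Icc (-((m.natAbs + n.natAbs : ℕ) : ℤ)) (m.natAbs + n.natAbs : ℕ) := by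
    rw [Finset.mem_Icc]; omega
  exact ⟨m.natAbs + n.natAbs, fun w => w ⟨m, hm⟩ ⟨n, hn⟩, fun v _ => ⟨by fun_prop, rfl⟩⟩

/-- Arity three is that of the coefficients f, g, h. The arithmetic operations below follow by
repeating an argument as a dummy. -/
theorem comp₃ {φ ψ χ : DynVars 𝕜 → 𝕜} (hφ : IsLocalOn X φ) (hψ : IsLocalOn X ψ)
    (hχ : IsLocalOn X χ) {F : 𝕜 × 𝕜 × 𝕜 → 𝕜}
    (hF : ∀ v ∈ X, ContDiffAt 𝕜 ∞ F (φ v, ψ v, χ v)) :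
    IsLocalOn X fun v => F (φ v, ψ v, χ v) := by
  obtain ⟨N₁, Φ₁, h₁⟩ := hφ
  obtain ⟨N₂, Φ₂, h₂⟩ := hψ
  obtain ⟨N₃, Φ₃, h₃⟩ := hχ
  obtain ⟨Ψ₁, k₁⟩ := enlarge (N' := N₁ + N₂ + N₃) (by omega) h₁
  obtain ⟨Ψ₂, k₂⟩ := enlarge (N' := N₁ + N₂ + N₃) (by omega) h₂
  obtain ⟨Ψ₃, k₃⟩ := enlarge (N' := N₁ + N₂ + N₃) (by omega) h₃
  refine ⟨_, fun w => F (Ψ₁ w, Ψ₂ w, Ψ₃ w), fun v hv => ⟨?_, ?_⟩⟩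
  · refine ContDiffAt.comp (g := F) _ ?_
      ((k₁ v hv).1.prodMk ((k₂ v hv).1.prodMk (k₃ v hv).1))
    rw [← (k₁ v hv).2, ← (k₂ v hv).2, ← (k₃ v hv).2]
    exact hF v hv
  · simp only [(k₁ v hv).2, (k₂ v hv).2, (k₃ v hv).2]

variable {φ ψ : DynVars 𝕜 → 𝕜}

theorem add (hφ : IsLocalOn X φ) (hψ : IsLocalOn X ψ) : IsLocalOn X fun v => φ v + ψ v :=
  comp₃ (F := fun w => w.1 + w.2.1) hφ hψ hφ fun _ _ => by fun_prop

theorem sub (hφ : IsLocalOn X φ) (hψ : IsLocalOn X ψ) : IsLocalOn X fun v => φ v - ψ v :=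
  comp₃ (F := fun w => w.1 - w.2.1) hφ hψ hφ fun _ _ => by fun_prop

theorem mul (hφ : IsLocalOn X φ) (hψ : IsLocalOn X ψ) : IsLocalOn X fun v => φ v * ψ v :=
  comp₃ (F := fun w => w.1 * w.2.1) hφ hψ hφ fun _ _ => by fun_prop

theorem neg (hφ : IsLocalOn X φ) : IsLocalOn X fun v => -φ v :=
  comp₃ (F := fun w => -w.1) hφ hφ hφ fun _ _ => by fun_prop

theorem const (c : 𝕜) : IsLocalOn X fun _ => c :=
  comp₃ (F := fun _ => c) (coord 0 0) (coord 0 0) (coord 0 0) fun _ _ => by fun_prop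

theorem div (hφ : IsLocalOn X φ) (hψ : IsLocalOn X ψ) (h0 : ∀ v ∈ X, ψ v ≠ 0) :
    IsLocalOn X fun v => φ v / ψ v :=
  comp₃ (F := fun w => w.1 / w.2.1) hφ hψ hφ fun v hv =>
    contDiffAt_fst.div (contDiffAt_fst.comp _ contDiffAt_snd) (h0 v hv)

end IsLocalOn

theorem InImShiftSubOne.mono {Y : Set (DynVars 𝕜)} {φ : DynVars 𝕜 → 𝕜}
    (h : InImShiftSubOne X φ) (hY : Y ⊆ X) : InImShiftSubOne Y φ := by
  obtain ⟨σ, hσ, h⟩ := h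
  exact ⟨σ, hσ.mono hY, fun v hv => h v (hY hv)⟩

/-- Functions that differ by an element of `Im (T - 1)` lie in `Im (T - 1)` simultaneously. -/
theorem InImShiftSubOne.congr {φ ψ : DynVars 𝕜 → 𝕜} (h : InImShiftSubOne X φ)
    (hd : InImShiftSubOne X fun v => ψ v - φ v) : InImShiftSubOne X ψ := by
  obtain ⟨σ, hσ, h⟩ := h
  obtain ⟨τ, hτ, k⟩ := hd
  refine ⟨fun v => σ v + τ v, hσ.add hτ, fun v hv => ?_⟩
  linear_combination h v hv + k v hv

theorem InImShiftSubOne.neg {φ : DynVars 𝕜 → 𝕜} (h : InImShiftSubOne X φ) :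
    InImShiftSubOne X fun v => -φ v := by
  obtain ⟨σ, hσ, h⟩ := h
  refine ⟨fun v => -σ v, hσ.neg, fun v hv => ?_⟩
  linear_combination -h v hv

end DynVars

open DynVars

/-! ### Shift invariance of the point sets and locality of the coefficients. -/

namespace VolterraLattice

variable {𝕜 : Type u} [RCLike 𝕜] {L : VolterraLattice 𝕜}

theorem regular_shift {v : DynVars 𝕜} (hv : v ∈ L.regular) (k : ℤ) : v.shift k ∈ L.regular := by
  refine ⟨fun m n => hv.1 _ _, fun n => hv.2.1 _, fun n => ?_⟩
  have := hv.2.2 (n + k)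
  simpa only [shift_apply, add_right_comm _ k, sub_add_eq_add_sub] using this

theorem generic_subset_regular : L.generic ⊆ L.regular := fun _ hv => hv.1

theorem generic_shift {v : DynVars 𝕜} (hv : v ∈ L.generic) (k : ℤ) : v.shift k ∈ L.generic :=
  ⟨regular_shift hv.1 k, fun n => by simpa only [shift_shift] using hv.2 (n + k)⟩

theorem mem_dom {v : DynVars 𝕜} (hv : v ∈ L.regular) : (v 1 (-1), v 1 0, v 0 (-1)) ∈ L.dom := by
  simpa using hv.2.2 0

/-- A directional logarithmic derivative of a smooth function without zeros is smooth. -/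
theorem contDiffAt_logDeriv_line {s : Set (𝕜 × 𝕜 × 𝕜)} (hs : IsOpen s)
    {F : 𝕜 × 𝕜 × 𝕜 → 𝕜} (hF : ContDiffOn 𝕜 ∞ F s) (h0 : ∀ w ∈ s, F w ≠ 0)
    (ℓ : 𝕜 × 𝕜 × 𝕜 → 𝕜 → 𝕜 × 𝕜 × 𝕜) (π : 𝕜 × 𝕜 × 𝕜 → 𝕜) (e : 𝕜 × 𝕜 × 𝕜)
    (hℓ : ∀ w, HasDerivAt (ℓ w) e (π w)) (hπ : ∀ w, ℓ w (π w) = w)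
    {w : 𝕜 × 𝕜 × 𝕜} (hw : w ∈ s) :
    ContDiffAt 𝕜 ∞ (fun w => logDeriv (fun t => F (ℓ w t)) (π w)) w := by
  have hd : ∀ w ∈ s, logDeriv (fun t => F (ℓ w t)) (π w) = fderiv 𝕜 F w e / F w := by
    intro w hw
    have hFd : HasFDerivAt F (fderiv 𝕜 F w) (ℓ w (π w)) := by
      rw [hπ w]
      exact (((hF.contDiffAt (hs.mem_nhds hw))).differentiableAt (by simp)).hasFDerivAt
    have := hFd.comp_hasDerivAt (π w) (hℓ w)
    rw [logDeriv_apply, hπ w]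
    congr 1
    exact this.deriv
  have h1 : ContDiffOn 𝕜 ∞ (fun w => fderiv 𝕜 F w e / F w) s :=
    ((hF.fderiv_of_isOpen hs (m := ∞) (by simp)).clm_apply contDiffOn_const).div hF h0
  exact ((h1.congr hd).contDiffAt (hs.mem_nhds hw))

namespace IsOnSphere

theorem isLocalOn_comp (hL : L.IsOnSphere) {F : 𝕜 × 𝕜 × 𝕜 → 𝕜} (hF : ContDiffOn 𝕜 ∞ F L.dom) :
    IsLocalOn L.regular fun v => F (v 1 (-1), v 1 0, v 0 (-1)) :=
  .comp₃ (.coord _ _) (.coord _ _) (.coord _ _)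
    fun _ hv => hF.contDiffAt (hL.isOpen_dom.mem_nhds (mem_dom hv))

theorem isLocalOn_fv (hL : L.IsOnSphere) : IsLocalOn L.regular L.fv :=
  hL.isLocalOn_comp hL.smooth_f

theorem isLocalOn_gv (hL : L.IsOnSphere) : IsLocalOn L.regular L.gv :=
  hL.isLocalOn_comp hL.smooth_g

theorem isLocalOn_hv (hL : L.IsOnSphere) : IsLocalOn L.regular L.hv :=
  hL.isLocalOn_comp hL.smooth_h

theorem isLocalOn_logX (hL : L.IsOnSphere) : IsLocalOn L.regular L.logX :=
  hL.isLocalOn_comp fun _ hw => (contDiffAt_logDeriv_line hL.isOpen_dom hL.smooth_f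
    (fun _ h => hL.f_ne_zero _ _ _ h) (fun w t => (t, w.2.1, w.2.2)) (fun w => w.1) (1, 0, 0)
    (fun _ => (hasDerivAt_id _).prodMk ((hasDerivAt_const _ _).prodMk (hasDerivAt_const _ _)))
    (fun _ => rfl) hw).contDiffWithinAt

theorem isLocalOn_logY (hL : L.IsOnSphere) : IsLocalOn L.regular L.logY :=
  hL.isLocalOn_comp fun _ hw => (contDiffAt_logDeriv_line hL.isOpen_dom hL.smooth_f
    (fun _ h => hL.f_ne_zero _ _ _ h) (fun w t => (w.1, t, w.2.2)) (fun w => w.2.1) (0, 1, 0)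
    (fun _ => (hasDerivAt_const _ _).prodMk ((hasDerivAt_id _).prodMk (hasDerivAt_const _ _)))
    (fun _ => rfl) hw).contDiffWithinAt

theorem isLocalOn_logZ (hL : L.IsOnSphere) : IsLocalOn L.regular L.logZ :=
  hL.isLocalOn_comp fun _ hw => (contDiffAt_logDeriv_line hL.isOpen_dom hL.smooth_f
    (fun _ h => hL.f_ne_zero _ _ _ h) (fun w t => (w.1, w.2.1, t)) (fun w => w.2.2) (0, 0, 1)
    (fun _ => (hasDerivAt_const _ _).prodMk ((hasDerivAt_const _ _).prodMk (hasDerivAt_id _)))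
    (fun _ => rfl) hw).contDiffWithinAt

theorem fv_ne_zero (hL : L.IsOnSphere) {v : DynVars 𝕜} (hv : v ∈ L.regular) : L.fv v ≠ 0 :=
  hL.f_ne_zero _ _ _ (mem_dom hv)

theorem isLocalOn_pv (hL : L.IsOnSphere) : IsLocalOn L.regular L.pv :=
  (hL.isLocalOn_logX.div hL.isLocalOn_fv fun _ hv => hL.fv_ne_zero hv).neg

theorem isLocalOn_coefA (hL : L.IsOnSphere) : IsLocalOn L.regular L.coefA :=
  (((IsLocalOn.coord _ _).mul hL.isLocalOn_fv).add
    ((IsLocalOn.coord _ _).mul hL.isLocalOn_gv)).add hL.isLocalOn_hv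

theorem isLocalOn_coefB (hL : L.IsOnSphere) : IsLocalOn L.regular L.coefB :=
  (hL.isLocalOn_fv.add ((IsLocalOn.coord _ _).mul hL.isLocalOn_gv)).add
    ((IsLocalOn.coord _ _).mul hL.isLocalOn_hv)

theorem isLocalOn_coefC (hL : L.IsOnSphere) : IsLocalOn L.regular L.coefC :=
  have h {φ : DynVars 𝕜 → 𝕜} (hφ : IsLocalOn L.regular φ) :=
    hφ.shift 1 fun _ hv => regular_shift hv 1
  ((h hL.isLocalOn_pv).mul (h hL.isLocalOn_gv)).add ((h hL.isLocalOn_logZ).add hL.isLocalOn_logY)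

theorem logX_eq (hL : L.IsOnSphere) {v : DynVars 𝕜} (hv : v ∈ L.regular) :
    L.logX v = -(L.pv v * L.fv v) := by
  rw [pv, neg_mul, neg_neg, div_mul_cancel₀ _ (hL.fv_ne_zero hv)]

theorem sphere_shift (hL : L.IsOnSphere) {v : DynVars 𝕜} (hv : v ∈ L.regular) (k : ℤ) :
    v (1 + k) k * L.fv (v.shift k) + L.gv (v.shift k) + v k (-1 + k) * L.hv (v.shift k) = 0 := by
  simpa [fv, gv, VolterraLattice.hv] using hL.sphere _ _ _ (mem_dom (regular_shift hv k))

/-! ### Comparison of BC - AD with D_x(log f). -/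

/-- `B C - A D` and `D_x (log f)` differ by an element of `Im (T - 1)`. -/
theorem sub_dxLogF_mem (hL : L.IsOnSphere) (hc : L.LeadingCondition) :
    InImShiftSubOne L.regular
      fun w => L.coefB w * L.coefC w - L.coefA w * L.coefD w - L.dxLogF w := by
  have hs {φ : DynVars 𝕜 → 𝕜} (hφ : IsLocalOn L.regular φ) :=
    hφ.shift (-1) fun _ hv => regular_shift hv (-1)
  have lp := hL.isLocalOn_pv
  have lf := hL.isLocalOn_fv
  have lg := hL.isLocalOn_gv
  have lh := hL.isLocalOn_hv
  -- Since D_x v_{1,0} = A_1 + B and D_x v_{0,-1} = A + B_{-1}, the derivatives in v_{1,0} and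
  -- v_{0,-1} differ by (T-1) of the first two terms. The remaining terms absorb p f D_x v_{1,-1}:
  -- the leading condition trades pf for -p_1h in the part containing v_{2,-1}, which is then the
  -- shift of the part containing v_{1,-2}.
  refine ⟨fun v => L.coefB (v.shift (-1)) * L.logZ v - L.coefA v * L.logY (v.shift (-1))
    - L.pv v * L.fv v * L.hv (v.shift (-1)) * v 1 (-2)
    + L.pv v * L.gv v * L.gv (v.shift (-1)) * v 0 (-1)
    - L.pv v * L.fv v * L.fv (v.shift (-1)) * v 1 0
    - L.pv v * L.hv v * L.fv (v.shift (-1)) * v 0 (-1)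
    - L.pv v * L.hv v * L.hv (v.shift (-1)) * v (-1) (-2), ?_, fun v hv => ?_⟩
  · exact (((((((hs hL.isLocalOn_coefB).mul hL.isLocalOn_logZ).sub
      (hL.isLocalOn_coefA.mul (hs hL.isLocalOn_logY))).sub
      (((lp.mul lf).mul (hs lh)).mul (.coord _ _))).add
      (((lp.mul lg).mul (hs lg)).mul (.coord _ _))).sub
      (((lp.mul lf).mul (hs lf)).mul (.coord _ _))).sub
      (((lp.mul lh).mul (hs lf)).mul (.coord _ _))).sub
      (((lp.mul lh).mul (hs lh)).mul (.coord _ _))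
  · have h1 := hL.sphere_shift hv 1
    have h2 := hL.sphere_shift hv (-1)
    have h3 := hc v hv
    have h4 : v 0 0 = 1 := hv.2.1 0
    have h5 : v 1 1 = 1 := hv.2.1 1
    have h6 : v (-1) (-1) = 1 := hv.2.1 (-1)
    simp only [dxLogF, dx, hL.logX_eq hv, coefA, coefB, coefC, coefD, shift_shift, shift_apply,
      Int.reduceAdd, Int.reduceSub, Int.reduceNeg, shift_zero, zero_add, zero_sub,
      sub_self, h4, h5, h6] at *
    generalize L.pv (v.shift 1) = p₁ at *
    generalize L.pv v = p at *
    linear_combination p₁ * L.fv v * h1 - p * L.hv v * h2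
      + (L.fv (v.shift 1) * v 2 (-1) + L.gv (v.shift 1) * v 1 (-1)
        + L.hv (v.shift 1) * v 0 (-1)) * h3

end IsOnSphere

/-! ### The operator S acting on sequences of vectors. -/

section Vectors

variable {E : Type v} [AddCommGroup E] [Module 𝕜 E] {B : LinearMap.BilinForm 𝕜 E}

theorem gram_shift_apply (V : ℤ → E) (n i j : ℤ) :
    (gram B V).shift n i j = B (V (i + n)) (V (j + n)) := rfl

theorem form_field_succ (hB : B.IsSymm) {V : ℤ → E} (h1 : ∀ n, B (V n) (V n) = 1) (n : ℤ) :
    B (V n) (L.field B V (n + 1)) = L.coefA (((gram B V).shift n).shift 1) := by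
  simp only [field, coefA, map_add, map_smul, smul_eq_mul, shift_shift, gram_shift_apply]
  ring_nf
  rw [h1, hB.eq (V n) (V (2 + n)), hB.eq (V n) (V (1 + n))]
  ring

theorem form_field_pred {V : ℤ → E} (h1 : ∀ n, B (V n) (V n) = 1) (n : ℤ) :
    B (V n) (L.field B V (n - 1)) = L.coefB (((gram B V).shift n).shift (-1)) := by
  simp only [field, coefB, map_add, map_smul, smul_eq_mul, shift_shift, gram_shift_apply]
  ring_nf
  rw [h1]
  ring

theorem form_pred_field (hB : B.IsSymm) {V : ℤ → E} (h1 : ∀ n, B (V n) (V n) = 1) (n : ℤ) :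
    B (V (n - 1)) (L.field B V n) = L.coefA ((gram B V).shift n) := by
  have := form_field_succ (L := L) hB h1 (n - 1)
  rwa [sub_add_cancel, shift_shift, add_sub_cancel] at this

theorem form_succ_field {V : ℤ → E} (h1 : ∀ n, B (V n) (V n) = 1) (n : ℤ) :
    B (V (n + 1)) (L.field B V n) = L.coefB ((gram B V).shift n) := by
  have := form_field_pred (L := L) h1 (n + 1)
  rwa [add_sub_cancel_right, shift_shift, neg_add_cancel_comm_assoc] at this

/-- The expansion of `S V_x - δH/δV` in the vectors of the sequence. -/
theorem opS_field_sub_varDerivLogF (hB : B.IsSymm) {V : ℤ → E} (h1 : ∀ n, B (V n) (V n) = 1)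
    (p q r : DynVars 𝕜 → 𝕜) (n : ℤ) {w w₁ w' : DynVars 𝕜} (hw : w = (gram B V).shift n)
    (hw₁ : w₁ = w.shift 1) (hw' : w' = w.shift (-1)) :
    opS B p q r V (L.field B V) n - L.varDerivLogF B V n =
      (-(p w₁ * L.fv w₁) - L.logX w₁) • V (n + 2)
      + (L.coefA w * r w + L.coefA w₁ * q w₁
          - (p w₁ * L.gv w₁ + (L.logZ w₁ + L.logY w))) • V (n + 1)
      + (p w * L.fv w' - p w₁ * L.hv w₁) • V n
      + (p w * L.gv w' - (L.logZ w + L.logY w')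
          - (L.coefB w * r w + L.coefB w' * q w)) • V (n - 1)
      + (p w * L.hv w' - L.logX w') • V (n - 2) := by
  have e1 : (gram B V).shift (n + 1) = w₁ := by rw [hw₁, hw, shift_shift, add_comm]
  have e2 : (gram B V).shift (n - 1) = w' := by
    rw [hw', hw, shift_shift, neg_add_eq_sub]
  simp only [opS, varDerivLogF, form_field_succ hB h1, form_field_pred h1,
    form_pred_field hB h1, form_succ_field h1, ← hw, ← hw₁, ← hw', e1, e2]
  simp only [field, e1, e2, sub_add_cancel, add_sub_cancel_right,
    show n - 1 - 1 = n - 2 by ring, show n + 1 + 1 = n + 2 by ring]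
  module

theorem isSkew_opS (hB : B.IsSymm) (p q r : DynVars 𝕜 → 𝕜) (V : ℤ → E) :
    IsSkew B (opS B p q r V) := by
  intro U W hU
  set P : ℤ → 𝕜 := fun n => p ((gram B V).shift n)
  set Q : ℤ → 𝕜 := fun n => q ((gram B V).shift n)
  -- The r-terms cancel pointwise, and ⟨U, SW⟩ + ⟨SU, W⟩ = τ_n - τ_{n+1}. Finite support of U makes
  -- this sum to zero.
  set τ : ℤ → 𝕜 := fun n => P n * (B (U n) (W (n - 1)) + B (U (n - 1)) (W n))
    - Q n * (B (V n) (W (n - 1)) * B (U n) (V (n - 1)) + B (V n) (U (n - 1)) * B (V (n - 1)) (W n))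
    with hτ
  have hfin (k : ℤ) : {n | U (n + k) ≠ 0}.Finite :=
    hU.preimage (f := fun n => n + k) (add_left_injective k).injOn
  have hfin' : {n | U (n - 1) ≠ 0}.Finite := hfin (-1)
  have hτf : τ.support.Finite := by
    refine (hU.union hfin').subset fun n hn => ?_
    by_contra h
    simp only [Set.mem_union, Function.mem_support, Set.mem_ofPred_eq, not_or, not_not] at h
    simp [hτ, h.1, h.2] at hn
  have h1 : (fun n => B (U n) (opS B p q r V W n)).support.Finite := by
    refine hU.subset fun n hn h => ?_
    simp [h] at hn
  have h2 : (fun n => B (opS B p q r V U n) (W n)).support.Finite := by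
    refine ((hU.union hfin').union (hfin 1)).subset fun n hn => ?_
    by_contra h
    simp only [Set.mem_union, Function.mem_support, Set.mem_ofPred_eq, not_or, not_not] at h
    simp [opS, h.1.1, h.1.2, h.2] at hn
  have hτs : (fun n => τ (n + 1)).support.Finite :=
    hτf.preimage (f := fun n => n + 1) (add_left_injective 1).injOn
  have h3 : ∑ᶠ n, τ (n + 1) = ∑ᶠ n, τ n := finsum_comp_equiv (Equiv.addRight (1 : ℤ))
  rw [eq_neg_iff_add_eq_zero, ← finsum_add_distrib h1 h2, ← sub_eq_zero.2 h3.symm,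
    ← finsum_sub_distrib hτf hτs]
  refine finsum_congr fun n => ?_
  simp only [hτ, opS, map_add, map_sub, map_smul, smul_eq_mul, LinearMap.add_apply,
    LinearMap.sub_apply, LinearMap.smul_apply, add_sub_cancel_right, P, Q]
  rw [hB.eq (V (n + 1)) (U n), hB.eq (U (n + 1)) (V n), hB.eq (V (n - 1)) (U n)]
  ring

end Vectors

/-! ### Presymplectic form, linear system and the image of T - 1. -/

/-- Every symmetric array is the array of scalar products of a linearly independent sequence. -/
theorem exists_gram_eq {v : DynVars 𝕜} (hv : ∀ m n, v m n = v n m) :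
    ∃ (B : LinearMap.BilinForm 𝕜 (ULift.{v} (ℤ →₀ 𝕜))) (V : ℤ → ULift.{v} (ℤ →₀ 𝕜))
      (c : ℤ → ULift.{v} (ℤ →₀ 𝕜) →ₗ[𝕜] 𝕜), B.IsSymm ∧ gram B V = v ∧
        ∀ i j, c i (V j) = if j = i then 1 else 0 := by
  -- The free module on ℤ carries the form with matrix v, and V is its basis; `ULift` only adjusts
  -- the universe.
  let e : ULift.{v} (ℤ →₀ 𝕜) ≃ₗ[𝕜] (ℤ →₀ 𝕜) := ULift.moduleEquiv
  let B₀ : LinearMap.BilinForm 𝕜 (ℤ →₀ 𝕜) :=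
    Finsupp.linearCombination 𝕜 fun i => Finsupp.linearCombination 𝕜 (v i)
  have hB₀ : B₀ = LinearMap.flip B₀ := by
    ext i j
    simp [B₀, hv i j]
  refine ⟨B₀.compl₁₂ e.toLinearMap e.toLinearMap, fun i => e.symm (Finsupp.single i 1),
    fun i => Finsupp.lapply i ∘ₗ e.toLinearMap, ⟨fun x y => ?_⟩, ?_, fun i j => ?_⟩
  · exact LinearMap.congr_fun₂ hB₀ (e x) (e y)
  · funext m n
    simp [gram, B₀]
  · simp [Finsupp.single_apply]

theorem systemSolvable_of_hasPresymplecticForm (hL : L.IsOnSphere)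
    (h : HasPresymplecticForm.{u, v} L) : L.SystemSolvable := by
  obtain ⟨p, q, r, lam, -, hq, hr, -, h⟩ := h
  have key : ∀ v ∈ L.generic, p (v.shift 1) = L.pv (v.shift 1) ∧
      L.coefA v * r v + L.coefA (v.shift 1) * q (v.shift 1)
        - (p (v.shift 1) * L.gv (v.shift 1) + (L.logZ (v.shift 1) + L.logY v)) = 0 ∧
      p v * L.gv (v.shift (-1)) - (L.logZ v + L.logY (v.shift (-1)))
        - (L.coefB v * r v + L.coefB (v.shift (-1)) * q v) = 0 := by
    intro v hv
    obtain ⟨B, V, c, hB, hG, hc⟩ := exists_gram_eq.{u, v} hv.1.1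
    have h1 : ∀ n, B (V n) (V n) = 1 := fun n => by
      have := hv.1.2.1 n
      rwa [← hG] at this
    have hE := opS_field_sub_varDerivLogF (L := L) hB h1 p q r 0 rfl rfl rfl
    rw [(h _ B hB V (hG ▸ hv)).2 0, add_sub_cancel_left] at hE
    simp only [shift_zero, hG] at hE
    -- The coordinate functionals isolate the coefficients of V_2, V_1 and V_{-1}; the first
    -- determines p because f_1 ≠ 0.
    have h2 := congrArg (c 2) hE
    have h3 := congrArg (c 1) hE
    have h4 := congrArg (c (-1)) hE
    simp [hc] at h2 h3 h4
    refine ⟨?_, by linear_combination -h3, by linear_combination -h4⟩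
    rw [hL.logX_eq (regular_shift hv.1 1)] at h2
    exact mul_right_cancel₀ (hL.fv_ne_zero (regular_shift hv.1 1)) (by linear_combination h2)
  have hp : ∀ v ∈ L.generic, p v = L.pv v := fun v hv => by
    have := (key _ (generic_shift hv (-1))).1
    rwa [shift_shift, add_neg_cancel, shift_zero] at this
  refine ⟨q, r, hq, hr, fun v hv => ⟨?_, ?_⟩⟩
  · have := (key v hv).2.1
    rw [(key v hv).1] at this
    exact sub_eq_zero.1 this
  · have := (key v hv).2.2
    rw [hp v hv] at this
    exact (sub_eq_zero.1 this).symm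

theorem hasPresymplecticForm_of_systemSolvable (hL : L.IsOnSphere) (hc : L.LeadingCondition)
    (h : L.SystemSolvable) : HasPresymplecticForm.{u, v} L := by
  obtain ⟨q, r, hq, hr, h⟩ := h
  have hs {φ : DynVars 𝕜 → 𝕜} (hφ : IsLocalOn L.regular φ) (k : ℤ) :=
    hφ.shift k fun _ hv => regular_shift hv k
  have hg {φ : DynVars 𝕜 → 𝕜} (hφ : IsLocalOn L.regular φ) := hφ.mono generic_subset_regular
  -- Here λ is the coefficient of V in S V_x, as δH/δV contains no V. The coefficient of V_{-2}
  -- vanishes by the leading condition at site -1.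
  refine ⟨L.pv, q, r, fun v => L.pv v * L.fv (v.shift (-1)) - L.pv (v.shift 1) * L.hv (v.shift 1),
    hg hL.isLocalOn_pv, hq, hr, hg ((hL.isLocalOn_pv.mul (hs hL.isLocalOn_fv _)).sub
      ((hs hL.isLocalOn_pv _).mul (hs hL.isLocalOn_hv _))), ?_⟩
  intro E _ _ B hB V hV
  refine ⟨isSkew_opS hB _ _ _ _, fun n => ?_⟩
  have hE := opS_field_sub_varDerivLogF (L := L) hB hV.1.2.1 L.pv q r n rfl rfl rfl
  have hw := generic_shift hV n
  generalize (gram B V).shift n = w at *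
  have h0 := hc _ (regular_shift hw.1 (-1))
  rw [shift_shift, add_neg_cancel, shift_zero] at h0
  rw [← sub_eq_iff_eq_add', hE, (h w hw).1, (h w hw).2, hL.logX_eq (regular_shift hw.1 1),
    hL.logX_eq (regular_shift hw.1 (-1)), coefC, coefD, sub_neg_eq_add, add_comm, sub_neg_eq_add,
    add_comm (_ * L.hv _), h0]
  simp

/-- B times the first equation minus A times the second eliminates r and leaves B A_1 q_1 - A B_{-1}
q. -/
theorem mem_image_of_systemSolvable (hL : L.IsOnSphere) (h : L.SystemSolvable) :
    InImShiftSubOne L.generic fun w => L.coefB w * L.coefC w - L.coefA w * L.coefD w := by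
  obtain ⟨q, r, hq, hr, h⟩ := h
  refine ⟨fun v => L.coefA v * L.coefB (v.shift (-1)) * q v,
    ((hL.isLocalOn_coefA.mul (hL.isLocalOn_coefB.shift _
      fun _ hv => regular_shift hv _)).mono generic_subset_regular).mul hq, fun v hv => ?_⟩
  simp only [shift_shift, neg_add_cancel, shift_zero]
  linear_combination (-L.coefB v) * (h v hv).1 + L.coefA v * (h v hv).2

theorem generic_coef_ne_zero {v : DynVars 𝕜} (hv : v ∈ L.generic) (k : ℤ) :
    L.coefA v ≠ 0 ∧ L.coefB (v.shift k) ≠ 0 :=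
  ⟨by simpa using (hv.2 0).1, (hv.2 k).2⟩

/-- The elimination is reversed: q comes from σ = A B_{-1} q, then r from the first equation, and
the second holds by the choice of σ. -/
theorem systemSolvable_of_mem_image (hL : L.IsOnSphere)
    (h : InImShiftSubOne L.generic fun w => L.coefB w * L.coefC w - L.coefA w * L.coefD w) :
    L.SystemSolvable := by
  obtain ⟨σ, hσ, h⟩ := h
  have hg {φ : DynVars 𝕜 → 𝕜} (hφ : IsLocalOn L.regular φ) := hφ.mono generic_subset_regular
  refine ⟨fun v => σ v / (L.coefA v * L.coefB (v.shift (-1))),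
    fun v => (L.coefC v - σ (v.shift 1) / L.coefB v) / L.coefA v, ?_, ?_, fun v hv => ?_⟩
  · exact hσ.div (hg (hL.isLocalOn_coefA.mul (hL.isLocalOn_coefB.shift _
      fun _ hv => regular_shift hv _))) fun v hv => mul_ne_zero (generic_coef_ne_zero hv (-1)).1
        (generic_coef_ne_zero hv (-1)).2
  · refine ((hg hL.isLocalOn_coefC).sub ((hσ.shift 1 fun _ hv => generic_shift hv 1).div
      (hg hL.isLocalOn_coefB) fun v hv => ?_)).div (hg hL.isLocalOn_coefA)
        fun v hv => (generic_coef_ne_zero hv 0).1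
    simpa using (generic_coef_ne_zero hv 0).2
  · have hA := (generic_coef_ne_zero hv 0).1
    have hB := (generic_coef_ne_zero hv 0).2
    have hA' := (generic_coef_ne_zero (generic_shift hv 1) 0).1
    have hB' := (generic_coef_ne_zero hv (-1)).2
    have hv := h v hv
    simp only [shift_shift, neg_add_cancel, shift_zero] at *
    constructor
    · field_simp
      ring
    · field_simp
      linear_combination hv

theorem tfae_hasPresymplecticForm (hL : L.IsOnSphere) (hc : L.LeadingCondition) :
    List.TFAE
      [HasPresymplecticForm.{u, v} L,
       L.SystemSolvable,
       InImShiftSubOne L.generic fun w => L.coefB w * L.coefC w - L.coefA w * L.coefD w,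
       InImShiftSubOne L.generic L.dxLogF] := by
  have hd := (hL.sub_dxLogF_mem hc).mono generic_subset_regular
  tfae_have 1 → 2 := systemSolvable_of_hasPresymplecticForm hL
  tfae_have 2 → 1 := hasPresymplecticForm_of_systemSolvable hL hc
  tfae_have 2 → 3 := mem_image_of_systemSolvable hL
  tfae_have 3 → 2 := systemSolvable_of_mem_image hL
  tfae_have 4 → 3 := fun h => h.congr hd
  tfae_have 3 → 4 := fun h => h.congr (by simpa only [neg_sub] using hd.neg)
  tfae_finish

/-! ### A two-variable criterion for lattices given by fractions. -/

section Fraction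

variable {U : Set 𝕜} {a : 𝕜 → 𝕜} {c d Δ : 𝕜 → 𝕜 → 𝕜 → 𝕜}

theorem contDiffOn_comp_snd_fst {φ : 𝕜 → 𝕜} (hφ : ContDiffOn 𝕜 ∞ φ U) :
    ContDiffOn 𝕜 ∞ (fun w : 𝕜 × 𝕜 × 𝕜 => φ w.2.1) {w | w.2.1 ∈ U ∧ w.2.2 ∈ U} :=
  hφ.comp (t := U) (by fun_prop) fun _ hw => hw.1

theorem contDiffOn_comp_snd_snd {φ : 𝕜 → 𝕜} (hφ : ContDiffOn 𝕜 ∞ φ U) :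
    ContDiffOn 𝕜 ∞ (fun w : 𝕜 × 𝕜 × 𝕜 => φ w.2.2) {w | w.2.1 ∈ U ∧ w.2.2 ∈ U} :=
  hφ.comp (t := U) (by fun_prop) fun _ hw => hw.2

/-- The hypothesis `hs` is the sphere condition multiplied by Δ; it also fixes g = (z a(y) - y
a(z))/Δ. -/
theorem isOnSphere_ofFraction (hU : IsOpen U) (ha : ContDiffOn 𝕜 ∞ a U)
    (hc : ContDiff 𝕜 ∞ fun w : 𝕜 × 𝕜 × 𝕜 => c w.1 w.2.1 w.2.2)
    (hd : ContDiff 𝕜 ∞ fun w : 𝕜 × 𝕜 × 𝕜 => d w.1 w.2.1 w.2.2)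
    (hΔ : ContDiffOn 𝕜 ∞ (fun w : 𝕜 × 𝕜 × 𝕜 => Δ w.1 w.2.1 w.2.2) {w | w.2.1 ∈ U ∧ w.2.2 ∈ U})
    (hs : ∀ x, ∀ y ∈ U, ∀ z ∈ U, a z * c x y z - a y * d x y z = z * a y - y * a z) :
    (ofFraction U a c d Δ).IsOnSphere := by
  have hO : IsOpen {w : 𝕜 × 𝕜 × 𝕜 | w.2.1 ∈ U ∧ w.2.2 ∈ U} :=
    (hU.preimage (by fun_prop : Continuous fun w : 𝕜 × 𝕜 × 𝕜 => w.2.1)).inter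
      (hU.preimage (by fun_prop : Continuous fun w : 𝕜 × 𝕜 × 𝕜 => w.2.2))
  have hay := contDiffOn_comp_snd_fst ha
  have haz := contDiffOn_comp_snd_snd ha
  have hsub : (ofFraction U a c d Δ).dom ⊆ {w : 𝕜 × 𝕜 × 𝕜 | w.2.1 ∈ U ∧ w.2.2 ∈ U} :=
    fun w hw => ⟨hw.1, hw.2.1⟩
  have h0 : ∀ w ∈ (ofFraction U a c d Δ).dom, Δ w.1 w.2.1 w.2.2 ≠ 0 := fun w hw => hw.2.2.2
  refine ⟨?_, (haz.mono hsub).div (hΔ.mono hsub) h0, ?_, ?_, ?_, ?_⟩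
  · have h0 : IsOpen ({0}ᶜ : Set 𝕜) := isOpen_compl_singleton
    have h := (hΔ.continuousOn.isOpen_inter_preimage hO h0).inter
      (haz.continuousOn.isOpen_inter_preimage hO h0)
    refine (congrArg IsOpen (Set.ext fun w => ?_)).mpr h
    constructor
    · rintro ⟨h1, h2, h3, h4⟩
      exact ⟨⟨⟨h1, h2⟩, h4⟩, ⟨h1, h2⟩, h3⟩
    · rintro ⟨⟨⟨h1, h2⟩, h4⟩, -, h3⟩
      exact ⟨h1, h2, h3, h4⟩
  · exact (((haz.mul hc.contDiffOn).sub (hay.mul hd.contDiffOn)).mono hsub).div (hΔ.mono hsub) h0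
  · exact (hay.neg.mono hsub).div (hΔ.mono hsub) h0
  · rintro x y z ⟨-, -, h1, h2⟩
    exact div_ne_zero h1 h2
  · rintro x y z ⟨h1, h2, h3, h4⟩
    change y * (a z / _) + (_ / Δ x y z) + z * (-a y / _) = 0
    rw [hs x y h1 z h2]
    ring

variable {b b' n : 𝕜 → 𝕜 → 𝕜} {a' θ : 𝕜 → 𝕜}

/-- A sufficient condition for `B C - A D ∈ Im (T - 1)` if `Δ = v_{1,-1} + b(v_{1,0}, v_{0,-1})`
with a symmetric function `b`. -/
theorem ofFraction_mem_image (hL : (ofFraction U a c d Δ).IsOnSphere)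
    (hs : ∀ x, ∀ y ∈ U, ∀ z ∈ U, a z * c x y z - a y * d x y z = z * a y - y * a z)
    (hΔ : ∀ x y z, Δ x y z = x + b y z) (hb : ∀ y z, b y z = b z y)
    (ha : ∀ t ∈ U, HasDerivAt a (a' t) t)
    (hb' : ∀ y ∈ U, ∀ z ∈ U, HasDerivAt (b y) (b' y z) z)
    (hn : ∀ y ∈ U, ∀ z ∈ U, a z * (b y z + n y z) = z * (z * a y - y * a z) - a y)
    (hZ : ∀ y ∈ U, ∀ z ∈ U, z * a y - y * a z - a z * b' y z = θ z * n y z)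
    (h₁ : ∀ y ∈ U, ∀ z ∈ U, 2 * (z * a y - y * a z) + n z y * a' y - n y z * a' z = 0)
    (h₂ : ∀ y ∈ U, ∀ z ∈ U, n z y * a y * b' z y = n y z * a z * b' y z) :
    (ofFraction U a c d Δ).LeadingCondition ∧
      InImShiftSubOne (ofFraction U a c d Δ).regular fun w =>
        (ofFraction U a c d Δ).coefB w * (ofFraction U a c d Δ).coefC w
          - (ofFraction U a c d Δ).coefA w * (ofFraction U a c d Δ).coefD w := by
  set L := ofFraction U a c d Δ with hLdef
  -- The function n measures how far A/a is from 1: ν = n(y,z)/Δ and, by symmetry of b, μ =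
  -- n(z,y)/Δ. That θ depends on one variable only lets θ(z) occur both here and at site -1.
  have key : ∀ v ∈ L.regular, a (v 0 (-1)) ≠ 0 ∧ a (v 1 0) ≠ 0 ∧ L.pv v = 1 / a (v 0 (-1)) ∧
      L.pv v * L.fv v + 1 / a (v 1 0) * L.hv v = 0 ∧
      ∃ μ ν : 𝕜, L.coefA v = a (v 0 (-1)) * (1 + ν) ∧ L.coefB v = -a (v 1 0) * (1 + μ) ∧
        L.gv v + a (v 0 (-1)) * L.logZ v - a' (v 0 (-1)) = θ (v 0 (-1)) * ν ∧
        a (v 1 0) * L.logY v - L.gv v = θ (v 1 0) * μ ∧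
        2 * L.gv v + μ * (a' (v 1 0) + a (v 1 0) * L.logY v)
          - ν * (a (v 0 (-1)) * L.logZ v) = 0 := by
    intro v hv
    obtain ⟨hy, hz, haz, hD⟩ := mem_dom hv
    -- The domain only asks for a(z) ≠ 0; nonvanishing at y is the same condition at the next site.
    have hay : a (v 1 0) ≠ 0 := by simpa using (mem_dom (regular_shift hv 1)).2.2.1
    simp only [logX, logY, logZ, pv, coefA, coefB, fv, gv, VolterraLattice.hv, hLdef, ofFraction,
      logDeriv_apply] at *
    generalize v 1 (-1) = x at *
    generalize v 1 0 = y at *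
    generalize v 0 (-1) = z at *
    rw [hs x y hy z hz]
    simp only [hΔ] at *
    have dX : HasDerivAt (fun t => a z / (t + b y z)) (-(a z) / (x + b y z) ^ 2) x := by
      simpa using (hasDerivAt_const x (a z)).fun_div ((hasDerivAt_id x).add_const (b y z)) hD
    have dY : HasDerivAt (fun t => a z / (x + b t z)) (-(a z * b' z y) / (x + b y z) ^ 2) y := by
      simpa using (hasDerivAt_const y (a z)).fun_div (((hb' z hz y hy).congr_of_eventuallyEq
        (.of_forall fun t => hb t z)).const_add x) hD
    have dZ : HasDerivAt (fun t => a t / (x + b y t))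
        ((a' z * (x + b y z) - a z * b' y z) / (x + b y z) ^ 2) z :=
      (ha z hz).fun_div ((hb' y hy z hz).const_add x) hD
    rw [dX.deriv, dY.deriv, dZ.deriv]
    have hm := hn z hz y hy
    rw [hb z y] at hm
    have hn := hn y hy z hz
    have hY := hZ z hz y hy
    have hZ := hZ y hy z hz
    have h₁ := h₁ y hy z hz
    have h₂ := h₂ y hy z hz
    refine ⟨haz, hay, by field_simp, by field_simp; ring, n z y / (x + b y z),
      n y z / (x + b y z), ?_, ?_, ?_, ?_, ?_⟩
    · field_simp
      linear_combination -hn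
    · field_simp
      linear_combination hm
    · field_simp
      linear_combination hZ
    · field_simp
      linear_combination hY
    · field_simp
      -- `h₁` collects the terms of order 1/Δ, `h₂` those of order 1/Δ².
      linear_combination (x + b y z) * h₁ - h₂
  refine ⟨fun v hv => ?_, ?_⟩
  · have h := (key v hv).2.2.2.1
    have h' := (key _ (regular_shift hv 1)).2.2.1
    simp only [shift_apply, zero_add, neg_add_cancel] at h'
    rwa [h']
  · have hsh {φ : DynVars 𝕜 → 𝕜} (hφ : IsLocalOn L.regular φ) :=
      hφ.shift (-1) fun _ hv => regular_shift hv (-1)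
    -- In terms of μ, ν this is σ = -θ(μ_{-1} + ν + μ_{-1}ν) - a'(z). Modulo (T-1)σ all that remains
    -- of BC - AD is the negative of the last identity in `key`.
    refine ⟨fun v => L.coefA v * (L.pv v * L.gv (v.shift (-1)) - L.logY (v.shift (-1)))
      - (L.gv v + L.logZ v / L.pv v), ?_, fun v hv => ?_⟩
    · refine (hL.isLocalOn_coefA.mul ((hL.isLocalOn_pv.mul (hsh hL.isLocalOn_gv)).sub
        (hsh hL.isLocalOn_logY))).sub (hL.isLocalOn_gv.add
          (hL.isLocalOn_logZ.div hL.isLocalOn_pv fun v hv => ?_))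
      rw [(key v hv).2.2.1]
      exact one_div_ne_zero (key v hv).1
    · obtain ⟨hz, hy, hp, -, μ, ν, hA, hB, e1, e2, e3⟩ := key v hv
      obtain ⟨-, -, hp', -, μ', ν', hA', -, e1', -, -⟩ := key _ (regular_shift hv 1)
      obtain ⟨-, -, -, -, μ'', ν'', -, -, -, e2'', -⟩ := key _ (regular_shift hv (-1))
      simp only [coefC, coefD, shift_shift, shift_apply, Int.reduceNeg, shift_zero,
        zero_add, neg_add_cancel, hp, hp', hA, hA', hB, add_neg_cancel] at *
      generalize a (v 0 (-1)) = α at *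
      generalize a (v 1 0) = β at *
      generalize a' (v 0 (-1)) = α' at *
      generalize a' (v 1 0) = β' at *
      have i1 : L.logZ v = (θ (v 0 (-1)) * ν + α' - L.gv v) / α := by
        field_simp
        linear_combination e1
      have i2 : L.logY v = (θ (v 1 0) * μ + L.gv v) / β := by
        field_simp
        linear_combination e2
      have i3 : L.logZ (v.shift 1) = (θ (v 1 0) * ν' + β' - L.gv (v.shift 1)) / β := by
        field_simp
        linear_combination e1'
      have i4 : L.logY (v.shift (-1)) = (θ (v 0 (-1)) * μ'' + L.gv (v.shift (-1))) / α := by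
        field_simp
        linear_combination e2''
      rw [i1, i2] at e3
      rw [i1, i2, i3, i4]
      field_simp at e3 ⊢
      linear_combination -e3

end Fraction

/-! ### Verification for the six families. -/

/-- The lattice satisfies the hypotheses of the criterion, and `B C - A D ∈ Im (T - 1)` on the set
of regular points. -/
def IsConserved (L : VolterraLattice 𝕜) : Prop :=
  L.IsOnSphere ∧ L.LeadingCondition ∧
    InImShiftSubOne L.regular fun w => L.coefB w * L.coefC w - L.coefA w * L.coefD w

theorem hasDerivAt_deriv_of_isOpen {U : Set 𝕜} (hU : IsOpen U) {φ : 𝕜 → 𝕜}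
    (hφ : ContDiffOn 𝕜 ∞ φ U) {t : 𝕜} (ht : t ∈ U) : HasDerivAt φ (deriv φ t) t :=
  ((hφ.contDiffAt (hU.mem_nhds ht)).differentiableAt (by simp)).hasDerivAt

/-- Serves to differentiate the algebraic equation of a branch, which yields the derivative of the
branch. -/
theorem hasDerivAt_eq_zero_of_forall_eq_zero {U : Set 𝕜} (hU : IsOpen U) {F : 𝕜 → 𝕜}
    (hF : ∀ t ∈ U, F t = 0) {t F' : 𝕜} (ht : t ∈ U) (h : HasDerivAt F F' t) : F' = 0 :=
  (h.congr_of_eventuallyEq (Filter.eventually_of_mem (hU.mem_nhds ht)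
    fun s hs => (hF s hs).symm)).unique (hasDerivAt_const t 0)

theorem isConserved_lattice1 : (lattice1 : VolterraLattice 𝕜).IsConserved := by
  have ha : ContDiffOn 𝕜 ∞ (fun t : 𝕜 => t - 1 / t) {t | t ≠ 0} :=
    contDiffOn_id.sub (contDiffOn_const.div contDiffOn_id fun _ h => h)
  have hs : ∀ x : 𝕜, ∀ y ∈ {t : 𝕜 | t ≠ 0}, ∀ z ∈ {t : 𝕜 | t ≠ 0},
      (z - 1 / z) * -y - (y - 1 / y) * -z = z * (y - 1 / y) - y * (z - 1 / z) :=
    fun _ _ _ _ _ => by ring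
  have hL : (lattice1 : VolterraLattice 𝕜).IsOnSphere :=
    isOnSphere_ofFraction isOpen_ne ha (by fun_prop) (by fun_prop) (by fun_prop) hs
  refine ⟨hL, ofFraction_mem_image (b := fun y z => -(y * z)) (b' := fun y _ => -y)
    (n := fun y z => (y - 1 / y) * z) (a' := fun t => 1 + 1 / t ^ 2) (θ := fun _ => 1)
    hL hs (fun _ _ _ => sub_eq_add_neg _ _) (fun _ _ => by ring) (fun t ht => ?_)
    (fun y _ z _ => ?_) ?_ ?_ ?_ ?_⟩
  · refine ((hasDerivAt_id t).fun_sub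
      ((hasDerivAt_const t (1 : 𝕜)).fun_div (hasDerivAt_id t) ht)).congr_deriv ?_
    simp only [id]
    ring
  · exact ((hasDerivAt_id z).const_mul y).fun_neg.congr_deriv (by ring)
  all_goals
    intro y (hy : y ≠ 0) z (hz : z ≠ 0)
    field_simp
  all_goals ring

theorem isConserved_lattice2 (k : 𝕜) {U : Set 𝕜} {a : 𝕜 → 𝕜} (hU : IsOpen U)
    (ha : ContDiffOn 𝕜 ∞ a U) (ha' : ∀ t ∈ U, a t ^ 2 - 2 * k * t * a t + t ^ 2 - 1 = 0) :
    (lattice2 U a).IsConserved := by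
  have hs : ∀ x : 𝕜, ∀ y ∈ U, ∀ z ∈ U, a z * -y - a y * -z = z * a y - y * a z :=
    fun _ _ _ _ _ => by ring
  have hL : (lattice2 U a).IsOnSphere :=
    isOnSphere_ofFraction hU ha (by fun_prop) (by fun_prop)
      ((ContDiff.contDiffOn (by fun_prop)).add
        ((contDiffOn_comp_snd_snd ha).mul (contDiffOn_comp_snd_fst ha))) hs
  have hd (t : 𝕜) (ht : t ∈ U) := hasDerivAt_deriv_of_isOpen hU ha ht
  have h2 (t : 𝕜) (ht : t ∈ U) : (a t - k * t) * deriv a t = k * a t - t := by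
    have := hasDerivAt_eq_zero_of_forall_eq_zero hU ha' ht (((((hd t ht).fun_pow 2).sub
      (((hasDerivAt_id t).const_mul (2 * k)).mul (hd t ht))).add
        ((hasDerivAt_id t).fun_pow 2)).sub_const 1)
    simp at this
    linear_combination this / 2
  -- A double root of the quadratic is impossible on a smooth branch: a = kt would give ka = t, and
  -- the equation would become -1 = 0.
  have hu (t : 𝕜) (ht : t ∈ U) : a t - k * t ≠ 0 := by
    intro h0
    have h3 := h2 t ht
    rw [h0, zero_mul] at h3
    refine one_ne_zero (α := 𝕜) ?_
    linear_combination -ha' t ht + (a t - k * t) * h0 + t * h3 + k * t * h0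
  -- The witness n is found by solving `hn` with the quadratic used to replace z² - 1, and θ by
  -- dividing `hZ` by n.
  refine ⟨hL, ofFraction_mem_image (b := fun y z => -(y * z) + a z * a y)
    (b' := fun y z => -y + a y * deriv a z) (n := fun y z => -2 * a y * (a z - k * z))
    (a' := deriv a) (θ := fun t => -(t - a t * deriv a t) / (2 * (a t - k * t)))
    hL hs (fun _ _ _ => by ring) (fun _ _ => by ring) hd
    (fun y _ z hz => ?_) (fun y hy z hz => ?_) (fun y hy z hz => ?_) (fun y hy z hz => ?_)
    (fun y hy z hz => ?_)⟩
  · exact (((hasDerivAt_id z).const_mul y).fun_neg.fun_add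
      ((hd z hz).mul_const (a y))).congr_deriv (by ring)
  · linear_combination -a y * ha' z hz
  · have e : ∀ X u β : 𝕜, u ≠ 0 → -X / (2 * u) * (-2 * β * u) = X * β := fun X u β hu => by
      field_simp
    rw [e _ _ _ (hu z hz)]
    ring
  · linear_combination -2 * a z * h2 y hy + 2 * a y * h2 z hz
  · linear_combination -2 * a z ^ 2 * a y * h2 y hy + 2 * a y ^ 2 * a z * h2 z hz

theorem mul_eps_sub_mul_eps {ε : 𝕜} (U : Set 𝕜) :
    ∀ _ : 𝕜, ∀ y ∈ U, ∀ z ∈ U,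
      (z + ε) * ε - (y + ε) * ε = z * (y + ε) - y * (z + ε) :=
  fun _ _ _ _ _ => by ring

theorem isConserved_lattice3 {ε : 𝕜} (hε : ε ^ 2 = 1) : (lattice3 ε).IsConserved := by
  have hL : (lattice3 ε).IsOnSphere :=
    isOnSphere_ofFraction isOpen_univ (by fun_prop) (by fun_prop) (by fun_prop) (by fun_prop)
      (mul_eps_sub_mul_eps _)
  refine ⟨hL, ofFraction_mem_image (b := fun _ _ => -1) (b' := fun _ _ => 0)
    (n := fun y z => ε * (z - y)) (a' := fun _ => 1) (θ := fun _ => 1) hL (mul_eps_sub_mul_eps _)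
    (fun _ _ _ => sub_eq_add_neg _ _) (fun _ _ => rfl)
    (fun t _ => (hasDerivAt_id t).add_const ε) (fun _ _ _ _ => hasDerivAt_const _ _)
    (fun y _ z _ => ?_) (fun y _ z _ => ?_) (fun y _ z _ => ?_) (fun y _ z _ => ?_)⟩
  · linear_combination (z - y) * hε
  · ring
  · ring
  · ring

theorem isConserved_lattice4 {ε η : 𝕜} (k : 𝕜) (hε : ε ^ 2 = 1) (hη : η ≠ 0) {U : Set 𝕜}
    {p : 𝕜 → 𝕜} (hU : IsOpen U) (hp : ContDiffOn 𝕜 ∞ p U)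
    (hp' : ∀ t ∈ U, t + ε ≠ 0 ∧ η * p t ^ 2 = (t - ε) / (t + ε) - k) :
    (lattice4 ε k η U p).IsConserved := by
  have hL : (lattice4 ε k η U p).IsOnSphere :=
    isOnSphere_ofFraction hU (by fun_prop) (by fun_prop) (by fun_prop)
      ((ContDiff.contDiffOn (by fun_prop)).add
        ((ContDiff.contDiffOn (by fun_prop)).mul (contDiffOn_const.add (contDiffOn_const.mul
          ((contDiffOn_comp_snd_snd hp).mul (contDiffOn_comp_snd_fst hp))))))
      (mul_eps_sub_mul_eps _)
  have hd (t : 𝕜) (ht : t ∈ U) := hasDerivAt_deriv_of_isOpen hU hp ht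
  have h1 (t : 𝕜) (ht : t ∈ U) : (t + ε) * (η * p t ^ 2 + k - 1) + 2 * ε = 0 := by
    obtain ⟨h0, h⟩ := hp' t ht
    rw [h]
    field_simp
    ring
  have h2 (t : 𝕜) (ht : t ∈ U) : η * p t * deriv p t * (t + ε) ^ 2 = ε := by
    have := hasDerivAt_eq_zero_of_forall_eq_zero hU h1 ht
      ((((hasDerivAt_id t).add_const ε).mul
        (((((hd t ht).fun_pow 2).const_mul η).add_const k).sub_const 1)).add_const (2 * ε))
    simp at this
    linear_combination (t + ε) / 2 * this - h1 t ht / 2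
  -- A smooth branch of the square root avoids its branch point: p = 0 would contradict the
  -- differentiated equation, as ε ≠ 0. This makes θ well defined.
  have h0 (t : 𝕜) (ht : t ∈ U) : p t ≠ 0 := by
    intro h
    have := h2 t ht
    rw [h] at this
    refine one_ne_zero (α := 𝕜) ?_
    linear_combination -hε - ε * this
  refine ⟨hL, ofFraction_mem_image
    (b := fun y z => -(y * z) + (y + ε) * (z + ε) * (k + η * (p z * p y)))
    (b' := fun y z => -y + (y + ε) * (k + η * (p z * p y))
      + (y + ε) * (z + ε) * (η * (deriv p z * p y)))
    (n := fun y z => η * (z + ε) * (y + ε) * p z * (p z - p y))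
    (a' := fun _ => 1) (θ := fun t => (1 - k + η * p t ^ 2) / (2 * η * p t ^ 2))
    hL (mul_eps_sub_mul_eps _) (fun _ _ _ => by ring) (fun _ _ => by ring)
    (fun t _ => (hasDerivAt_id t).add_const ε)
    (fun y _ z hz => ?_) (fun y hy z hz => ?_) (fun y hy z hz => ?_) (fun y hy z hz => ?_)
    (fun y hy z hz => ?_)⟩
  · exact (((hasDerivAt_id z).const_mul y).fun_neg.fun_add
      ((((hasDerivAt_id z).add_const ε).const_mul (y + ε)).fun_mul
        ((((hd z hz).mul_const (p y)).const_mul η).const_add k))).congr_deriv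
          (by simp only [id]; ring)
  · linear_combination (z + ε) * (y + ε) * h1 z hz - (y + ε) * hε
  · have hz0 := h0 z hz
    have e : (1 - k + η * p z ^ 2) / (2 * η * p z ^ 2)
        * (η * (z + ε) * (y + ε) * p z * (p z - p y))
          = (1 - k + η * p z ^ 2) * (z + ε) * (y + ε) * (p z - p y) / (2 * p z) := by
      field_simp
    rw [e, eq_div_iff (by simpa using hz0)]
    linear_combination (-2 * (y + ε) * p y) * h2 z hz - (p z + p y) * (y + ε) * h1 z hz
  · linear_combination (z + ε) * h1 y hy - (y + ε) * h1 z hz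
  -- Both sides of `h₂` reduce to an expression symmetric in y and z.
  · have W : ∀ y ∈ U, ∀ z ∈ U, η * (z + ε) * (y + ε) * p z * (p z - p y) * (z + ε)
        * (-y + (y + ε) * (k + η * (p z * p y)) + (y + ε) * (z + ε) * (η * (deriv p z * p y)))
        = η ^ 2 * (z + ε) ^ 2 * (y + ε) ^ 2 * p z * p y * (p z - p y) ^ 2
          - η * ε * (z + ε) * (y + ε) * (p z - p y) * ((z + ε) * p z - (y + ε) * p y) := by
      intro y hy z hz
      linear_combination η * (z + ε) * (y + ε) ^ 2 * p y * (p z - p y) * h2 z hz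
        + η * (z + ε) ^ 2 * (y + ε) * p z * (p z - p y) * h1 y hy
    rw [W y hy z hz, W z hz y hy]
    ring

/-- Of the square root only (t + ε)s' = s/2 matters. The factor k in `hs'` admits k = 0 with the
placeholder s = 0. -/
theorem isConserved_lattice5 {ε : 𝕜} (k : 𝕜) (hε : ε ^ 2 = 1) {U : Set 𝕜} {s : 𝕜 → 𝕜}
    (hU : IsOpen U) (hs : ContDiffOn 𝕜 ∞ s U)
    (hs' : ∀ t ∈ U, k * ((t + ε) * deriv s t) = k * s t / 2) :
    (lattice5 ε k U s).IsConserved := by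
  have hL : (lattice5 ε k U s).IsOnSphere :=
    isOnSphere_ofFraction hU (by fun_prop) (by fun_prop) (by fun_prop)
      ((ContDiff.contDiffOn (by fun_prop)).add (contDiffOn_const.mul
          ((contDiffOn_comp_snd_fst hs).mul (contDiffOn_comp_snd_snd hs))))
      (mul_eps_sub_mul_eps _)
  refine ⟨hL, ofFraction_mem_image
    (b := fun y z => ε * (y + z) + 1 + k * (s y * s z))
    (b' := fun y z => ε + k * (s y * deriv s z))
    (n := fun y z => -2 * ε * (y + ε) - k * s y * s z)
    (a' := fun _ => 1) (θ := fun _ => 1 / 2)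
    hL (mul_eps_sub_mul_eps _) (fun _ _ _ => by ring) (fun _ _ => by ring)
    (fun t _ => (hasDerivAt_id t).add_const ε)
    (fun y _ z hz => ?_) (fun y hy z hz => ?_) (fun y hy z hz => ?_) (fun y hy z hz => ?_)
    (fun y hy z hz => ?_)⟩
  · exact (((((hasDerivAt_id z).const_add y).const_mul ε).add_const 1).fun_add
      (((hasDerivAt_deriv_of_isOpen hU hs hz).const_mul (s y)).const_mul k)).congr_deriv (by ring)
  · linear_combination -(z + y + 2 * ε) * hε
  · linear_combination -s y * hs' z hz
  · ring
  · linear_combination (-2 * ε * (z + ε) - k * s z * s y) * s z * hs' y hy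
      - (-2 * ε * (y + ε) - k * s y * s z) * s y * hs' z hz

/-- Here Δ would not contain v_{1,-1}, so the fraction criterion does not apply. Instead log f
depends on v_{1,0} alone; in D_x v_{1,0} the two terms (1 + δv_{1,0})/(v_{1,0} + δ) cancel and the
rest telescopes. -/
theorem isConserved_lattice6 (δ : 𝕜) : (lattice6 δ).IsConserved := by
  have h1 : ContDiff 𝕜 ∞ fun w : 𝕜 × 𝕜 × 𝕜 => w.2.1 + δ := by fun_prop
  have h2 : ContDiff 𝕜 ∞ fun w : 𝕜 × 𝕜 × 𝕜 => w.2.2 + δ := by fun_prop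
  have hL : (lattice6 δ).IsOnSphere := by
    refine ⟨(isOpen_compl_singleton.preimage h1.continuous).inter
      (isOpen_compl_singleton.preimage h2.continuous), ?_, ?_, ?_, ?_, ?_⟩
    · exact contDiffOn_const.div h1.contDiffOn fun _ hw => hw.1
    · exact (contDiffOn_const.div h1.contDiffOn fun _ hw => hw.1).sub
        (contDiffOn_const.div h2.contDiffOn fun _ hw => hw.2)
    · exact contDiffOn_const.div h2.contDiffOn fun _ hw => hw.2
    · rintro x y z ⟨hy, -⟩
      exact one_div_ne_zero hy
    · rintro x y z ⟨hy : y + δ ≠ 0, hz : z + δ ≠ 0⟩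
      simp only [lattice6]
      field_simp
      ring
  have hX : ∀ v, (lattice6 δ).logX v = 0 := fun v => by simp [logX, lattice6, logDeriv_apply]
  have hZ : ∀ v, (lattice6 δ).logZ v = 0 := fun v => by simp [logZ, lattice6, logDeriv_apply]
  have hc : (lattice6 δ).LeadingCondition := fun v _ => by simp [pv, hX]
  refine ⟨hL, hc, InImShiftSubOne.congr ⟨fun v => -((v 1 (-1) + δ * v 0 (-1))
    / ((v 1 0 + δ) * (v 0 (-1) + δ)) + δ / (v 0 (-1) + δ)), ?_, fun v hv => ?_⟩
      (hL.sub_dxLogF_mem hc)⟩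
  · refine (((IsLocalOn.coord _ _).add ((IsLocalOn.const _).mul (.coord _ _))).div
      (((IsLocalOn.coord _ _).add (.const _)).mul ((IsLocalOn.coord _ _).add (.const _)))
      fun v hv => ?_).add ((IsLocalOn.const _).div ((IsLocalOn.coord _ _).add (.const _))
      fun v hv => ?_) |>.neg
    · exact mul_ne_zero (mem_dom hv).1 (mem_dom hv).2
    · exact (mem_dom hv).2
  · have hy : v 1 0 + δ ≠ 0 := (mem_dom hv).1
    have hz : v 0 (-1) + δ ≠ 0 := (mem_dom hv).2
    have hy₁ : v 2 1 + δ ≠ 0 := (mem_dom (regular_shift hv 1)).1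
    have hd : HasDerivAt (fun t => 1 / (t + δ)) (-1 / (v 1 0 + δ) ^ 2) (v 1 0) := by
      simpa using (hasDerivAt_const (v 1 0) (1 : 𝕜)).fun_div
        ((hasDerivAt_id (v 1 0)).add_const δ) hy
    have h0 : v 0 0 = 1 := hv.2.1 0
    have h1 : v 1 1 = 1 := hv.2.1 1
    have hY : (lattice6 δ).logY v = -1 / (v 1 0 + δ) := by
      simp only [logY, lattice6, logDeriv_apply, hd.deriv]
      field_simp
    have hf : ∀ v, (lattice6 δ).fv v = 1 / (v 1 0 + δ) := fun _ => rfl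
    have hg : ∀ v, (lattice6 δ).gv v = δ / (v 1 0 + δ) - δ / (v 0 (-1) + δ) := fun _ => rfl
    have hh : ∀ v, (lattice6 δ).hv v = -1 / (v 0 (-1) + δ) := fun _ => rfl
    simp only [dxLogF, hX, hZ, hY, dx, hf, hg, hh, shift_apply,
      Int.reduceAdd, Int.reduceSub, zero_add, neg_add_cancel, zero_sub, sub_self, h0, h1, add_zero]
    field_simp
    ring

theorem IsListed.isConserved {L : VolterraLattice 𝕜} (h : L.IsListed) : L.IsConserved := by
  have sq {ε : 𝕜} (hε : ε = 1 ∨ ε = -1) : ε ^ 2 = 1 := by rcases hε with rfl | rfl <;> ring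
  cases h with
  | v1 => exact isConserved_lattice1
  | v2 k U a hU ha ha' => exact isConserved_lattice2 k hU ha ha'
  | v3 ε hε => exact isConserved_lattice3 (sq hε)
  | v4 ε k η hε hη U p hU hp hp' =>
    exact isConserved_lattice4 k (sq hε) (by rcases hη with rfl | rfl <;> simp) hU hp hp'
  | v5_zero ε hε =>
    exact isConserved_lattice5 0 (sq hε) isOpen_univ contDiffOn_const fun _ _ => by simp
  | v5_two ε k η hε hk hη U s hU hs hs' =>
    refine isConserved_lattice5 (k * η) (sq hε) hU hs fun t ht => ?_
    -- This gives 2ηss' = 1, hence (t + ε)s' = ηs²s' = s/2.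
    have := hasDerivAt_eq_zero_of_forall_eq_zero hU (F := fun t => η * s t ^ 2 - (t + ε))
      (fun t ht => sub_eq_zero.2 (hs' t ht)) ht
      ((((hasDerivAt_deriv_of_isOpen hU hs ht).fun_pow 2).const_mul η).sub
        ((hasDerivAt_id t).add_const ε))
    simp at this
    rw [← hs' t ht]
    linear_combination k * η * s t / 2 * this
  | v6 δ _ => exact isConserved_lattice6 δ

end VolterraLattice

theorem mainTheorem2 {𝕜 : Type u} [RCLike 𝕜] :
    -- every lattice of the list has a presymplectic form
    (∀ L : VolterraLattice 𝕜, L.IsListed → VolterraLattice.HasPresymplecticForm.{u, v} L) ∧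
    -- the solvability conditions are equivalent
    (∀ L : VolterraLattice 𝕜, L.IsOnSphere → L.LeadingCondition →
      List.TFAE
        [VolterraLattice.HasPresymplecticForm.{u, v} L,
         L.SystemSolvable,
         DynVars.InImShiftSubOne L.generic
           (fun w => L.coefB w * L.coefC w - L.coefA w * L.coefD w),
         DynVars.InImShiftSubOne L.generic L.dxLogF]) ∧
    -- they apply to, and hold for, every lattice of the list
    (∀ L : VolterraLattice 𝕜, L.IsListed →
      L.IsOnSphere ∧ L.LeadingCondition ∧
      DynVars.InImShiftSubOne L.generic
        (fun w => L.coefB w * L.coefC w - L.coefA w * L.coefD w) ∧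
      DynVars.InImShiftSubOne L.regular L.dxLogF) := by
  refine ⟨fun L h => ?_, fun L => VolterraLattice.tfae_hasPresymplecticForm, fun L h => ?_⟩
  · obtain ⟨hL, hc, hi⟩ := h.isConserved
    -- The indices count from 0: this passes from (c) to (a).
    exact ((VolterraLattice.tfae_hasPresymplecticForm hL hc).out 2 0).1
      (hi.mono VolterraLattice.generic_subset_regular)
  · obtain ⟨hL, hc, hi⟩ := h.isConserved
    exact ⟨hL, hc, hi.mono VolterraLattice.generic_subset_regular,
      hi.congr (by simpa only [neg_sub] using (hL.sub_dxLogF_mem hc).neg)⟩
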